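/- Let $k\ge 1$ be fixed and let $n\ge k$. The input is a uniformly random permutation $(e_1,\dots,e_n)$ of $\{1,\dots,n\}$; the pivots $p_1<\dots<p_k$ are $e_1,\dots,e_k$ in sorted order, $p_0=0$, $p_{k+1}=n+1$. A non-pivot $x$ belongs to group $\mathrm A_h$ ($0\le h\le k$) if $p_h<x<p_{h+1}$, and $a_h=p_{h+1}-p_h-1$ is the size of $\mathrm A_h$. A comparison tree $\lambda$ is a binary search tree with inner nodes $\mathrm p_1,\dots,\mathrm p_k$ in inorder and leaves $\mathrm A_0,\dots,\mathrm A_k$ from left to right; it classifies an element of $\mathrm A_h$ with $\mathrm{depth}_\lambda(\mathrm A_h)$ comparisons, and $\mathrm{cost}^\lambda(b_0,\dots,b_k)=\sum_{h=0}^k \mathrm{depth}_\lambda(\mathrm A_h)\,b_h$. A classification tree is a $(k+1)$-way tree in which every inner node $v$ carries an index $i(v)\in\{k+1,\dots,n\}$ and a comparison tree $\lambda(v)$, the edges out of $v$ are labeled $0,\dots,k$, and each index in $\{k+1,\dots,n\}$ occurs exactly once on every path from the root to a leaf; at $v$ the element $e_{i(v)}$ is classified with $\lambda(v)$, and the edge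 labeled by its group is followed. Let $a^v_h$ be the number of edges labeled $h$ on the path from the root to $v$. A classification strategy assigns to all group sizes $(a_0,\dots,a_k)$ with $a_0+\dots+a_k=n-k$ a classification tree. Its average comparison count is the expected number of comparisons made when classifying the $n-k$ non-pivots, where the classification tree assigned to the group sizes of the input is used. Strategy $\mathcal O_k$ uses at every node $v$ a comparison tree $\lambda(v)$ that minimizes $\mathrm{cost}^{\lambda}(a_0-a_0^v,\dots,a_k-a_k^v)$ over all comparison trees $\lambda$. Strategy $\mathcal N_k$ uses at every node a comparison tree that minimizes $\mathrm{cost}^{\lambda}(a_0,\dots,a_k)$ over all comparison trees $\lambda$ (for instance, one fixed minimizer for all classifications). In both strategies the order in which the elements are classified, and the choice among several minimizers, are arbitrary. **Theorem.** For each $k\ge1$, strategy $\mathcal N_k$ is asymptotically optimal. That is, there are constants $\varepsilon>0$ and $C$, depending only on $k$, such that for every $n\ge k$ the average comparison count of $\mathcal N_k$ differs from that of the optimal strategy $\mathcal O_k$ by at most $C\,n^{1-\varepsilon}$, and it is at most $C\,n^{1-\varepsilon}$ larger than the average comparison count of any classification strategy for inputs of length $n$. -/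

import Mathlib

namespace MultiPivot

/-- A comparison tree for `k` pivots: a binary tree with `k` inner nodes, hence `k + 1` leaves.
The labels are forced by the shape: the inner nodes are `p_1, …, p_k` in inorder and the leaves are
`A_0, …, A_k` from left to right. -/
abbrev ComparisonTree (k : ℕ) : Type := {t : BinaryTree Unit // t.numNodes = k}

/-- The depth of the leaf number `h` (counted from the left, starting with `0`). -/
def leafDepth : BinaryTree Unit → ℕ → ℕ
  | .nil, _ => 0
  | .node _ l r, h =>
      1 + if h < l.numLeaves then leafDepth l h else leafDepth r (h - l.numLeaves)

/-- `depth_λ(A_h)`: the number of comparisons that the comparison tree `t` makes for an element of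
the group `A_h`. -/
def ComparisonTree.depth {k : ℕ} (t : ComparisonTree k) (h : Fin (k + 1)) : ℕ :=
  leafDepth t.1 h

/-- The cost `cost^λ(b_0, …, b_k) = ∑ h, depth_λ(A_h) * b_h` of a comparison tree. -/
def ComparisonTree.cost {k : ℕ} (t : ComparisonTree k) (b : Fin (k + 1) → ℤ) : ℤ :=
  ∑ h, (t.depth h : ℤ) * b h

/-- `t` has minimum cost with respect to `b_0, …, b_k` among all comparison trees. -/
def ComparisonTree.IsMinCost {k : ℕ} (t : ComparisonTree k) (b : Fin (k + 1) → ℤ) : Prop :=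
  ∀ t' : ComparisonTree k, t.cost b ≤ t'.cost b

/-- Classification trees: an inner node `v` carries an index `i(v)`, a comparison tree `λ(v)`, and
`k + 1` children, one for each possible outcome `A_0, …, A_k` of classifying the element with
index `i(v)`. Positions in the input are `0, …, n - 1`. -/
inductive ClassificationTree (k n : ℕ) : Type
  | leaf : ClassificationTree k n
  | node (i : Fin n) (t : ComparisonTree k)
      (child : Fin (k + 1) → ClassificationTree k n) : ClassificationTree k n

/-- On every path from the root to a leaf, each index from `s` occurs exactly once, and no other
index occurs. (So all paths have exactly `s.card` inner nodes.) -/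
def ClassificationTree.Classifies {k n : ℕ} : ClassificationTree k n → Finset (Fin n) → Prop
  | .leaf, s => s = ∅
  | .node i _ child, s => i ∈ s ∧ ∀ h, (child h).Classifies (s.erase i)

/-- `P` holds at every inner node `v` for the comparison tree `λ(v)` and the vector of the numbers
`a^v_h` of edges labeled `h` on the path from the root to `v`; here `u` is the vector at the root
of the given tree, which is `0` for a full classification tree. -/
def ClassificationTree.EveryNode {k n : ℕ} (P : ComparisonTree k → (Fin (k + 1) → ℕ) → Prop) :
    ClassificationTree k n → (Fin (k + 1) → ℕ) → Prop
  | .leaf, _ => True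
  | .node _ t child, u => P t u ∧ ∀ h, (child h).EveryNode P (u + Pi.single h 1)

/-- The number of comparisons made along the path that an input takes in a classification tree,
where `g i` is the group of the input element with index `i`. -/
def ClassificationTree.comparisons {k n : ℕ} (g : Fin n → Fin (k + 1)) :
    ClassificationTree k n → ℕ
  | .leaf => 0
  | .node i t child => t.depth (g i) + (child (g i)).comparisons g

/-- The indices of the non-pivots; the pivots are the first `k` elements of the input. -/
def nonPivots (k n : ℕ) : Finset (Fin n) := Finset.univ.filter fun i => k ≤ (i : ℕ)

/-- The pivots with value below the element with index `i`, for the input `σ 0, …, σ (n - 1)`. -/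
def pivotsBelow {n : ℕ} (k : ℕ) (σ : Equiv.Perm (Fin n)) (i : Fin n) : Finset (Fin n) :=
  Finset.univ.filter fun j => (j : ℕ) < k ∧ σ j < σ i

theorem card_pivotsBelow_lt {n : ℕ} (k : ℕ) (σ : Equiv.Perm (Fin n)) (i : Fin n) :
    (pivotsBelow k σ i).card < k + 1 := by
  have h : (pivotsBelow k σ i).card ≤ (Finset.range k).card :=
    Finset.card_le_card_of_injOn (fun j => (j : ℕ))
      (fun j hj => by
        have hj' : (j : ℕ) < k ∧ σ j < σ i := by simpa [pivotsBelow] using hj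
        simpa using hj'.1)
      (fun a _ b _ hab => Fin.ext hab)
  rw [Finset.card_range] at h
  omega

/-- The group of the element with index `i` in the input `σ`: a non-pivot `x` belongs to `A_h`,
that is `p_h < x < p_(h+1)`, exactly if `h` of the pivots are smaller than `x`. -/
def group {n : ℕ} (k : ℕ) (σ : Equiv.Perm (Fin n)) (i : Fin n) : Fin (k + 1) :=
  ⟨(pivotsBelow k σ i).card, card_pivotsBelow_lt k σ i⟩

/-- The group sizes `a_0, …, a_k` of the input `σ`. -/
def groupSizes {n : ℕ} (k : ℕ) (σ : Equiv.Perm (Fin n)) : Fin (k + 1) → ℕ := fun h =>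
  ((nonPivots k n).filter fun i => group k σ i = h).card

/-- A classification strategy for inputs of length `n`, which may know the group sizes
`a_0, …, a_k` (equivalently, the pivots `p_1, …, p_k`) in advance: a classification tree for each
vector of group sizes. -/
structure Strategy (k n : ℕ) where
  /-- The classification tree that is used for given group sizes. -/
  tree : (Fin (k + 1) → ℕ) → ClassificationTree k n
  classifies : ∀ a, (tree a).Classifies (nonPivots k n)

/-- The average comparison count `E(P_n)` for partitioning: the number of comparisons that are made
when classifying the non-pivots, averaged over all permutations of the input. -/
noncomputable def Strategy.averageCount {k n : ℕ} (S : Strategy k n) : ℝ :=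
  (∑ σ : Equiv.Perm (Fin n), ((S.tree (groupSizes k σ)).comparisons (group k σ) : ℝ)) /
    (n.factorial : ℝ)

/-- Strategy `O_k`: for given group sizes `a`, the comparison tree used at a node `v` minimizes the
cost with respect to the sizes `a_h - a^v_h` of the groups in the unclassified part of the input.
The order of classification and the choice among several minimizers are free. -/
def Strategy.IsO {k n : ℕ} (S : Strategy k n) : Prop :=
  ∀ a : Fin (k + 1) → ℕ, ∑ h, a h + k = n →
    (S.tree a).EveryNode (fun t u => t.IsMinCost fun h => (a h : ℤ) - (u h : ℤ)) 0

/-- Strategy `N_k`: for given group sizes `a`, the comparison tree used at every node minimizes the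
cost with respect to the full group sizes `a`. The order of classification and the choice among
several minimizers are free; in particular one fixed minimizer may be used at all nodes. -/
def Strategy.IsN {k n : ℕ} (S : Strategy k n) : Prop :=
  ∀ a : Fin (k + 1) → ℕ, ∑ h, a h + k = n →
    (S.tree a).EveryNode (fun t _ => t.IsMinCost fun h => (a h : ℤ)) 0

end MultiPivot

/-!
Given the group sizes `a` of the input, the sequence of groups met by a classification tree is a
draw without replacement from an urn with `a h` balls of colour `h`. When `m` balls are left, `b h`
of them with colour `h`, an optimal comparison tree minimizes the cost with respect to `b`, while
`N_k` minimizes it with respect to the initial proportions `p h = a h / ∑ i, a i`. As depths lie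
between `0` and `k`, the expected loss in this step is at most `k * ∑ h, |b h - m * p h| / m`. The
deviations `b h - m * p h` vanish at the start and have standard deviation at most of order `√m`, so
that the total loss is of order `∑ m ≤ n, 1 / √m`, that is `√n`. A potential function whose expected
decrease in each step dominates the loss turns this into an induction on the classification tree.
-/

namespace MultiPivot

open Finset

theorem sub_one_div_sqrt_le {x : ℝ} (hx : 0 ≤ x) : (x - 1) / √x ≤ x / √(x + 1) := by
  rcases hx.eq_or_lt with rfl | hx
  · simp
  calc (x - 1) / √x = √x - 1 / √x := by rw [sub_div, Real.div_sqrt]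
    _ ≤ √(x + 1) - 1 / √(x + 1) := by gcongr <;> linarith
    _ = (x + 1 - 1) / √(x + 1) := by rw [sub_div, Real.div_sqrt]
    _ = x / √(x + 1) := by rw [add_sub_cancel_right]

theorem add_one_div_sqrt_le {x : ℝ} (hx : 1 ≤ x) : (x + 1) / √x ≤ 2 * √(x + 1) := by
  have hsqrt : √(x + 1) ≤ 2 * √x := Real.sqrt_le_iff.2
    ⟨by positivity, by rw [mul_pow, Real.sq_sqrt (by linarith)]; linarith⟩
  rw [div_le_iff₀ (by positivity)]
  calc x + 1 = √(x + 1) * √(x + 1) := (Real.mul_self_sqrt (by linarith)).symm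
    _ ≤ √(x + 1) * (2 * √x) := by gcongr
    _ = 2 * √(x + 1) * √x := by ring

theorem add_one_mul_sqrt_le {x : ℝ} (hx : 0 ≤ x) :
    (x + 1) * √x ≤ (x + 1) * √(x + 1) - √(x + 1) / 2 := by
  have hx1 : √(x + 1) ^ 2 = x + 1 := Real.sq_sqrt (by linarith)
  have amgm := two_mul_le_add_sq (√x) (√(x + 1))
  rw [Real.sq_sqrt hx, hx1] at amgm
  calc (x + 1) * √x = √(x + 1) * (√x * √(x + 1)) := by
        linear_combination -√x * hx1
    _ ≤ √(x + 1) * (x + 1 / 2) := by gcongr; linarith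
    _ = (x + 1) * √(x + 1) - √(x + 1) / 2 := by ring

theorem single_one_le {κ : Type*} [DecidableEq κ] {b : κ → ℕ} {h : κ} (hh : b h ≠ 0) :
    Pi.single h 1 ≤ b := by
  intro j
  rw [Pi.single_apply]
  split_ifs with hj
  · exact hj ▸ Nat.one_le_iff_ne_zero.2 hh
  · exact Nat.zero_le _

section Urn

variable {κ : Type*} [Fintype κ]

/-- The deviation of the content `b` of an urn from the content of the same size with proportions
`p`. -/
def deviation (p : κ → ℝ) (b : κ → ℕ) (j : κ) : ℝ := b j - (∑ i, b i : ℕ) * p j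

/-- The sum of the squared deviations of the content `b` of an urn from the proportions `p`. -/
def sqDeviation (p : κ → ℝ) (b : κ → ℕ) : ℝ := ∑ j, deviation p b j ^ 2

theorem sqDeviation_nonneg (p : κ → ℝ) (b : κ → ℕ) : 0 ≤ sqDeviation p b :=
  sum_nonneg fun _ _ => sq_nonneg _

theorem sqDeviation_div_sum (a : κ → ℕ) : sqDeviation (fun h => a h / (∑ i, a i : ℕ)) a = 0 := by
  refine sum_eq_zero fun h _ => ?_
  rw [deviation, mul_div_cancel_of_imp', sub_self, zero_pow two_ne_zero]
  intro h0
  rw [Nat.cast_eq_zero, sum_eq_zero_iff] at h0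
  rw [h0 h (mem_univ h), Nat.cast_zero]

theorem two_mul_sum_abs_deviation_le (p : κ → ℝ) (b : κ → ℕ) {s : ℝ} (hs : 0 < s) :
    2 * ∑ j, |deviation p b j| ≤ sqDeviation p b / s + Fintype.card κ * s := by
  have amgm (x : ℝ) : 2 * |x| ≤ x ^ 2 / s + s := by
    rw [← sub_nonneg]
    have hsq : x ^ 2 / s + s - 2 * |x| = (|x| - s) ^ 2 / s := by
      rw [sub_sq, sq_abs]
      field_simp
      ring
    rw [hsq]
    positivity
  calc 2 * ∑ j, |deviation p b j| ≤ ∑ j, (deviation p b j ^ 2 / s + s) := by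
        rw [mul_sum]
        exact sum_le_sum fun j _ => amgm _
    _ = sqDeviation p b / s + Fintype.card κ * s := by
        rw [sum_add_distrib, ← sum_div, sqDeviation]
        simp

variable [DecidableEq κ] {b : κ → ℕ} {h : κ}

theorem sum_sub_single_add_one (hh : b h ≠ 0) :
    ∑ j, (b - Pi.single h 1 : κ → ℕ) j + 1 = ∑ j, b j := by
  conv_rhs => rw [← tsub_add_cancel_of_le (single_one_le hh)]
  simp only [Pi.add_apply, sum_add_distrib, sum_pi_single', mem_univ, if_true]

theorem deviation_sub_single (p : κ → ℝ) (hh : b h ≠ 0) (j : κ) :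
    deviation p (b - Pi.single h 1) j = deviation p b j + p j - (Pi.single h 1 : κ → ℝ) j := by
  have hsingle : (((Pi.single h 1 : κ → ℕ) j : ℕ) : ℝ) = (Pi.single h 1 : κ → ℝ) j := by
    simp [Pi.single_apply]
  rw [deviation, deviation, ← sum_sub_single_add_one hh, Pi.sub_apply,
    Nat.cast_sub (single_one_le hh j), hsingle]
  push_cast
  ring

theorem sum_mul_sqDeviation_sub_single (p : κ → ℝ) (b : κ → ℕ) :
    ∑ h, (b h : ℝ) * sqDeviation p (b - Pi.single h 1) =
      ((∑ h, b h : ℕ) - 2) * sqDeviation p b +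
        ∑ j, ((∑ h, b h : ℕ) * p j ^ 2 - 2 * (b j * p j) + b j) := by
  have expand (h j : κ) : (b h : ℝ) * deviation p (b - Pi.single h 1) j ^ 2 =
      b h * (deviation p b j + p j) ^ 2 +
        (Pi.single h (b h * (1 - 2 * (deviation p b h + p h))) : κ → ℝ) j := by
    by_cases hh : b h = 0
    · simp [hh]
    rw [deviation_sub_single p hh]
    by_cases hj : j = h
    · subst hj
      simp only [Pi.single_eq_same]
      ring
    · simp [hj]
  calc ∑ h, (b h : ℝ) * sqDeviation p (b - Pi.single h 1)
    _ = ∑ j, ((∑ h, b h : ℕ) * (deviation p b j + p j) ^ 2 +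
          b j * (1 - 2 * (deviation p b j + p j))) := by
        simp only [sqDeviation, mul_sum, expand, sum_add_distrib]
        rw [sum_comm]
        simp [sum_mul]
    _ = _ := by
        rw [sqDeviation, mul_sum, ← sum_add_distrib]
        refine sum_congr rfl fun j _ => ?_
        rw [deviation]
        ring

theorem sum_mul_sqDeviation_sub_single_le {p : κ → ℝ} (hp : ∀ h, 0 ≤ p h) (hp1 : ∑ h, p h ≤ 1)
    (b : κ → ℕ) :
    ∑ h, (b h : ℝ) * sqDeviation p (b - Pi.single h 1) ≤
      ((∑ h, b h : ℕ) - 2) * sqDeviation p b + 2 * (∑ h, b h : ℕ) := by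
  have hsq : ∑ h, p h ^ 2 ≤ 1 :=
    (sum_le_sum fun h _ => pow_le_of_le_one (hp h)
      ((single_le_sum (fun j _ => hp j) (mem_univ h)).trans hp1) two_ne_zero).trans hp1
  have hmul : 0 ≤ ∑ h, (b h : ℝ) * p h :=
    sum_nonneg fun h _ => mul_nonneg (Nat.cast_nonneg _) (hp h)
  rw [sum_mul_sqDeviation_sub_single, sum_add_distrib, sum_sub_distrib, ← mul_sum, ← mul_sum,
    ← Nat.cast_sum]
  have := mul_le_mul_of_nonneg_left hsq (Nat.cast_nonneg (α := ℝ) (∑ h, b h))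
  linarith

/-- The potential of the urn content `b`: its expected decrease when a random ball is drawn from the
`m` balls of the urn is at least `2 / m` times the sum of the absolute deviations from the
proportions `p`. For the empty urn, the quotient has the value `0`. -/
noncomputable def urnPotential (p : κ → ℝ) (b : κ → ℕ) : ℝ :=
  sqDeviation p b / √(∑ h, b h : ℕ) + 2 * (Fintype.card κ + 4) * √(∑ h, b h : ℕ)

theorem sum_mul_urnPotential_sub_single_eq {r : ℕ} (p : κ → ℝ) (hb : ∑ h, b h = r + 1) :
    ∑ h, (b h : ℝ) * urnPotential p (b - Pi.single h 1) =
      (∑ h, (b h : ℝ) * sqDeviation p (b - Pi.single h 1)) / √r +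
        2 * (Fintype.card κ + 4) * ((r + 1) * √r) := by
  have hb' : ∑ h, (b h : ℝ) = r + 1 := by exact_mod_cast hb
  rw [← hb', sum_mul, mul_sum, sum_div, ← sum_add_distrib]
  refine sum_congr rfl fun h _ => ?_
  by_cases hh : b h = 0
  · simp [hh]
  have hr : ∑ j, (b - Pi.single h 1 : κ → ℕ) j = r :=
    Nat.add_right_cancel ((sum_sub_single_add_one hh).trans hb)
  rw [urnPotential, hr]
  ring

theorem two_mul_sum_abs_deviation_add_sum_mul_urnPotential_le {p : κ → ℝ} (hp : ∀ h, 0 ≤ p h)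
    (hp1 : ∑ h, p h ≤ 1) (b : κ → ℕ) :
    2 * ∑ h, |deviation p b h| + ∑ h, (b h : ℝ) * urnPotential p (b - Pi.single h 1) ≤
      (∑ h, b h : ℕ) * urnPotential p b := by
  rcases h : ∑ j, b j with _ | r
  · have hb0 : ∀ j, b j = 0 := by simpa using h
    simp [deviation, hb0]
  rw [sum_mul_urnPotential_sub_single_eq p h, urnPotential, h, Nat.cast_succ]
  have hsq := sum_mul_sqDeviation_sub_single_le hp hp1 b
  rw [h, Nat.cast_succ] at hsq
  set D := sqDeviation p b
  set c : ℝ := (Fintype.card κ : ℝ)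
  set s := √((r : ℝ) + 1)
  have hr : (0 : ℝ) ≤ r := r.cast_nonneg
  have hs : 0 < s := by positivity
  have hdev : 2 * ∑ j, |deviation p b j| ≤ D / s + c * s := two_mul_sum_abs_deviation_le p b hs
  have hnoise : (r + 1) / √r ≤ 2 * s := by
    rcases Nat.eq_zero_or_pos r with rfl | hr1
    · simpa using hs.le
    · exact add_one_div_sqrt_le (by exact_mod_cast hr1)
  have hdrift : (∑ h, (b h : ℝ) * sqDeviation p (b - Pi.single h 1)) / √r ≤ r / s * D + 4 * s :=
    calc _ ≤ ((r + 1 - 2) * D + 2 * (r + 1)) / √r := by gcongr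
      _ = (r - 1) / √r * D + 2 * ((r + 1) / √r) := by ring
      _ ≤ r / s * D + 2 * (2 * s) :=
        add_le_add (mul_le_mul_of_nonneg_right (sub_one_div_sqrt_le hr) (sqDeviation_nonneg p b))
          (mul_le_mul_of_nonneg_left hnoise two_pos.le)
      _ = r / s * D + 4 * s := by ring
  have hsqrt : 2 * (c + 4) * ((r + 1) * √r) ≤ 2 * (c + 4) * ((r + 1) * s - s / 2) := by
    gcongr
    exact add_one_mul_sqrt_le hr
  linear_combination hdev + hdrift + hsqrt

end Urn

section Exchangeability

variable {α ι κ : Type*} [DecidableEq ι] [DecidableEq κ]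
  {Ω : Finset α} {X : α → ι → κ} {s : Finset ι} {b : κ → ℕ}

/-- For `ω` uniformly distributed in `Ω`, the random variables `X ω i` with `i ∈ s` are exchangeable
and take each value `h` exactly `b h` times. Exchangeability is witnessed by measure preserving maps
of `Ω` that induce the transpositions of the indices in `s`. -/
structure IsExchangeable (Ω : Finset α) (X : α → ι → κ) (s : Finset ι) (b : κ → ℕ) : Prop where
  exists_swap : ∀ i ∈ s, ∀ j ∈ s, ∃ e : Equiv.Perm α,
    ∀ ω, (ω ∈ Ω ↔ e ω ∈ Ω) ∧ ∀ x, X (e ω) x = X ω (Equiv.swap i j x)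
  card_filter_eq : ∀ ω ∈ Ω, ∀ h, #{i ∈ s | X ω i = h} = b h

theorem IsExchangeable.sum_eq_card [Fintype κ] (H : IsExchangeable Ω X s b) (hΩ : Ω.Nonempty) :
    ∑ h, b h = #s := by
  obtain ⟨ω, hω⟩ := hΩ
  rw [card_eq_sum_card_fiberwise (f := X ω) (t := univ) fun _ _ => mem_coe.2 (mem_univ _)]
  exact sum_congr rfl fun h _ => (H.card_filter_eq ω hω h).symm

theorem IsExchangeable.filter (H : IsExchangeable Ω X s b) {i : ι} (hi : i ∈ s) (h : κ) :
    IsExchangeable {ω ∈ Ω | X ω i = h} X (s.erase i) (b - Pi.single h 1) where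
  exists_swap x hx y hy := by
    obtain ⟨e, he⟩ := H.exists_swap x (mem_of_mem_erase hx) y (mem_of_mem_erase hy)
    refine ⟨e, fun ω => ⟨?_, (he ω).2⟩⟩
    rw [mem_filter, mem_filter, (he ω).1, (he ω).2,
      Equiv.swap_apply_of_ne_of_ne (ne_of_mem_erase hx).symm (ne_of_mem_erase hy).symm]
  card_filter_eq ω hω j := by
    obtain ⟨hω, hωi⟩ := mem_filter.1 hω
    rw [filter_erase, Pi.sub_apply, ← H.card_filter_eq ω hω j]
    by_cases hj : j = h
    · subst hj
      rw [card_erase_of_mem (mem_filter.2 ⟨hi, hωi⟩), Pi.single_eq_same]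
    · rw [erase_eq_of_notMem (by simp [hωi, Ne.symm hj]), Pi.single_eq_of_ne hj, tsub_zero]

theorem IsExchangeable.card_filter_mul_card (H : IsExchangeable Ω X s b) {i : ι} (hi : i ∈ s)
    (h : κ) : #{ω ∈ Ω | X ω i = h} * #s = #Ω * b h := by
  have card_eq (j) (hj : j ∈ s) : #{ω ∈ Ω | X ω j = h} = #{ω ∈ Ω | X ω i = h} := by
    obtain ⟨e, he⟩ := H.exists_swap i hi j hj
    refine card_equiv e fun ω => ?_
    rw [mem_filter, mem_filter, ← (he ω).1, (he ω).2, Equiv.swap_apply_left]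
  calc #{ω ∈ Ω | X ω i = h} * #s = ∑ j ∈ s, #{ω ∈ Ω | X ω j = h} := by
        rw [sum_congr rfl card_eq, sum_const, smul_eq_mul, mul_comm]
    _ = ∑ ω ∈ Ω, #{j ∈ s | X ω j = h} := by
        simp only [card_filter]
        exact sum_comm
    _ = #Ω * b h := by
        rw [sum_congr rfl fun ω hω => H.card_filter_eq ω hω h, sum_const, smul_eq_mul]

end Exchangeability

variable {k n : ℕ}

/-- The expected number of comparisons in a classification tree when the sequence of groups is
uniformly distributed over all sequences with `b h` members of `A_h`. -/
noncomputable def ClassificationTree.expected :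
    ClassificationTree k n → (Fin (k + 1) → ℕ) → ℝ
  | .leaf, _ => 0
  | .node _ t child, b =>
      (∑ h, (b h : ℝ) * (t.depth h + (child h).expected (b - Pi.single h 1))) / (∑ h, b h : ℕ)

namespace ClassificationTree

theorem sum_mul_expected_node (i : Fin n) (t : ComparisonTree k)
    (child : Fin (k + 1) → ClassificationTree k n) (b : Fin (k + 1) → ℕ) :
    (∑ h, b h : ℕ) * (node i t child).expected b =
      ∑ h, (t.depth h : ℝ) * b h + ∑ h, (b h : ℝ) * (child h).expected (b - Pi.single h 1) := by
  have hnode : (∑ h, b h : ℕ) * (node i t child).expected b =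
      ∑ h, (b h : ℝ) * (t.depth h + (child h).expected (b - Pi.single h 1)) := by
    refine mul_div_cancel_of_imp' fun hb => ?_
    have hb0 : ∀ h, b h = 0 := by simpa using Nat.cast_eq_zero.1 hb
    simp [hb0]
  rw [hnode, ← sum_add_distrib]
  exact sum_congr rfl fun h _ => by ring

theorem sum_comparisons_eq {α : Type*} {Ω : Finset α} {X : α → Fin n → Fin (k + 1)}
    {s : Finset (Fin n)} {b : Fin (k + 1) → ℕ} (T : ClassificationTree k n) (hT : T.Classifies s)
    (H : IsExchangeable Ω X s b) :
    ∑ ω ∈ Ω, (T.comparisons (X ω) : ℝ) = #Ω * T.expected b := by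
  induction T generalizing Ω s b with
  | leaf => simp [comparisons, expected]
  | node i t child ih =>
    rcases Ω.eq_empty_or_nonempty with rfl | hΩ
    · simp
    obtain ⟨hi, hchild⟩ := hT
    have hs : (#s : ℝ) ≠ 0 := Nat.cast_ne_zero.2 (card_ne_zero_of_mem hi)
    have hfiber (h) : ∑ ω ∈ Ω with X ω i = h, ((node i t child).comparisons (X ω) : ℝ) =
        #{ω ∈ Ω | X ω i = h} * (t.depth h + (child h).expected (b - Pi.single h 1)) := by
      rw [mul_add, ← ih h (hchild h) (H.filter hi h), ← nsmul_eq_mul, ← sum_const,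
        ← sum_add_distrib]
      refine sum_congr rfl fun ω hω => ?_
      rw [comparisons, (mem_filter.1 hω).2, Nat.cast_add]
    have hcard (h) : (#{ω ∈ Ω | X ω i = h} : ℝ) = #Ω * b h / #s := by
      rw [eq_div_iff hs]
      exact_mod_cast H.card_filter_mul_card hi h
    rw [← sum_fiberwise Ω (fun ω => X ω i), expected, H.sum_eq_card hΩ, mul_div_assoc', mul_sum,
      sum_div]
    refine sum_congr rfl fun h _ => ?_
    rw [hfiber, hcard]
    ring

theorem expected_node_le_add {t t' : ComparisonTree k}
    {child child' : Fin (k + 1) → ClassificationTree k n} {b : Fin (k + 1) → ℕ}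
    {E : (Fin (k + 1) → ℕ) → ℝ} (i i' : Fin n) (hb : ∑ h, b h ≠ 0)
    (hroot : ∑ h, (t.depth h : ℝ) * b h + ∑ h, (b h : ℝ) * E (b - Pi.single h 1) ≤
      ∑ h, (t'.depth h : ℝ) * b h + (∑ h, b h : ℕ) * E b)
    (hchild : ∀ h, b h ≠ 0 → (child h).expected (b - Pi.single h 1) ≤
      (child' h).expected (b - Pi.single h 1) + E (b - Pi.single h 1)) :
    (node i t child).expected b ≤ (node i' t' child').expected b + E b := by
  have hmul (h) : (b h : ℝ) * (child h).expected (b - Pi.single h 1) ≤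
      b h * ((child' h).expected (b - Pi.single h 1) + E (b - Pi.single h 1)) := by
    by_cases hh : b h = 0
    · simp [hh]
    · exact mul_le_mul_of_nonneg_left (hchild h hh) (Nat.cast_nonneg _)
  have hsum := sum_le_sum fun h (_ : h ∈ univ) => hmul h
  simp only [mul_add, sum_add_distrib] at hsum
  refine le_of_mul_le_mul_left ?_ (Nat.cast_pos.2 (Nat.pos_of_ne_zero hb) : (0 : ℝ) < _)
  rw [mul_add, sum_mul_expected_node, sum_mul_expected_node]
  linear_combination hsum + hroot

/-- Verification principle for an error bound `E`: in `hP`, the loss in a single step and the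
expected decrease of `E` are both multiplied by the number of unclassified elements. -/
theorem expected_le_add {P : ComparisonTree k → (Fin (k + 1) → ℕ) → Prop} {a : Fin (k + 1) → ℕ}
    {E : (Fin (k + 1) → ℕ) → ℝ} (hE : 0 ≤ E 0)
    (hP : ∀ t u, P t u → u ≤ a → ∀ t' : ComparisonTree k,
      ∑ h, (t.depth h : ℝ) * (a - u) h + ∑ h, ((a - u) h : ℝ) * E (a - u - Pi.single h 1) ≤
        ∑ h, (t'.depth h : ℝ) * (a - u) h + (∑ h, (a - u) h : ℕ) * E (a - u))
    {T T' : ClassificationTree k n} {s s' : Finset (Fin n)} {u : Fin (k + 1) → ℕ}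
    (hT : T.Classifies s) (hT' : T'.Classifies s') (hu : u ≤ a) (hs : ∑ h, (a - u) h = #s)
    (hs' : ∑ h, (a - u) h = #s') (hTP : T.EveryNode P u) :
    T.expected (a - u) ≤ T'.expected (a - u) + E (a - u) := by
  induction T generalizing T' s s' u with
  | leaf =>
    have hs0 : ∑ h, (a - u) h = 0 := by rw [hs, show s = ∅ from hT, card_empty]
    have hau : a - u = 0 := funext fun h => sum_eq_zero_iff.1 hs0 h (mem_univ h)
    cases T' with
    | leaf => simpa [expected, hau] using hE
    | node => exact absurd (hs'.symm.trans hs0) (card_ne_zero_of_mem hT'.1)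
  | node i t child ih =>
    cases T' with
    | leaf =>
      rw [show s' = ∅ from hT', card_empty, hs] at hs'
      exact absurd hs' (card_ne_zero_of_mem hT.1)
    | node i' t' child' =>
      have hs0 : ∑ h, (a - u) h ≠ 0 := hs ▸ card_ne_zero_of_mem hT.1
      refine expected_node_le_add i i' hs0 (hP t u hTP.1 hu t') fun h hh => ?_
      have hsub := sum_sub_single_add_one hh
      have hcard {s : Finset (Fin n)} {i} (hi : i ∈ s) (hs : ∑ h, (a - u) h = #s) :
          ∑ j, (a - u - Pi.single h 1 : Fin (k + 1) → ℕ) j = #(s.erase i) := by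
        rw [card_erase_of_mem hi, ← hs, ← hsub, Nat.add_sub_cancel]
      rw [tsub_tsub] at hcard ⊢
      exact ih h (hT.2 h) (hT'.2 h) (add_le_of_le_tsub_left_of_le hu (single_one_le hh))
        (hcard hT.1 hs) (hcard hT'.1 hs') (hTP.2 h)

end ClassificationTree

theorem leafDepth_le_numNodes (t : BinaryTree Unit) (h : ℕ) :
    leafDepth t h ≤ t.numNodes := by
  induction t generalizing h with
  | nil => simp [leafDepth]
  | node _ l r ihl ihr =>
    have := ihl h
    have := ihr (h - l.numLeaves)
    simp only [leafDepth, BinaryTree.numNodes]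
    split_ifs <;> omega

namespace ComparisonTree

theorem depth_le (t : ComparisonTree k) (h : Fin (k + 1)) : t.depth h ≤ k :=
  (leafDepth_le_numNodes t.1 h).trans t.2.le

theorem abs_depth_sub_depth_le (t t' : ComparisonTree k) (h : Fin (k + 1)) :
    |(t.depth h : ℝ) - t'.depth h| ≤ k :=
  abs_sub_le_of_nonneg_of_le (Nat.cast_nonneg _) (Nat.cast_le.2 (t.depth_le h))
    (Nat.cast_nonneg _) (Nat.cast_le.2 (t'.depth_le h))

theorem IsMinCost.sum_depth_mul_le {t : ComparisonTree k} {b : Fin (k + 1) → ℕ}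
    (ht : t.IsMinCost fun h => (b h : ℤ)) (t' : ComparisonTree k) :
    ∑ h, (t.depth h : ℝ) * b h ≤ ∑ h, (t'.depth h : ℝ) * b h := by
  have hcost := ht t'
  simp only [cost] at hcost
  exact_mod_cast hcost

theorem sum_depth_mul_le_add_sum_abs_deviation {t t' : ComparisonTree k} {p : Fin (k + 1) → ℝ}
    (htp : ∑ h, (t.depth h : ℝ) * p h ≤ ∑ h, (t'.depth h : ℝ) * p h) (b : Fin (k + 1) → ℕ) :
    ∑ h, (t.depth h : ℝ) * b h ≤
      ∑ h, (t'.depth h : ℝ) * b h + k * ∑ h, |deviation p b h| := by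
  have hdev : ∑ h, ((t.depth h : ℝ) - t'.depth h) * deviation p b h ≤
      k * ∑ h, |deviation p b h| := by
    rw [mul_sum]
    refine sum_le_sum fun h _ => (le_abs_self _).trans ?_
    rw [abs_mul]
    exact mul_le_mul_of_nonneg_right (t.abs_depth_sub_depth_le t' h) (abs_nonneg _)
  have hsplit : ∑ h, ((t.depth h : ℝ) - t'.depth h) * deviation p b h =
      ∑ h, (t.depth h : ℝ) * b h - ∑ h, (t'.depth h : ℝ) * b h -
        (∑ h, b h : ℕ) * (∑ h, (t.depth h : ℝ) * p h - ∑ h, (t'.depth h : ℝ) * p h) := by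
    simp only [mul_sum, ← sum_sub_distrib]
    exact sum_congr rfl fun h _ => by rw [deviation]; ring
  have hp : (∑ h, b h : ℕ) * (∑ h, (t.depth h : ℝ) * p h - ∑ h, (t'.depth h : ℝ) * p h) ≤ 0 :=
    mul_nonpos_of_nonneg_of_nonpos (Nat.cast_nonneg _) (sub_nonpos.2 htp)
  linarith

end ComparisonTree

namespace ClassificationTree

variable {T T' : ClassificationTree k n} {s : Finset (Fin n)} {a : Fin (k + 1) → ℕ}

theorem expected_le_of_isMinCost_sub (hT : T.Classifies s) (hT' : T'.Classifies s)
    (ha : ∑ h, a h = #s)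
    (hmin : T.EveryNode (fun t u => t.IsMinCost fun h => (a h : ℤ) - (u h : ℤ)) 0) :
    T.expected a ≤ T'.expected a := by
  have key := expected_le_add (a := a) (E := 0) le_rfl ?_ hT hT' zero_le
    (by simpa using ha) (by simpa using ha) hmin
  · simpa using key
  intro t u ht hu t'
  have hb : (fun h => (a h : ℤ) - (u h : ℤ)) = fun h => (((a - u) h : ℕ) : ℤ) :=
    funext fun h => (Nat.cast_sub (hu h)).symm
  simpa using (hb ▸ ht).sum_depth_mul_le t'

theorem expected_le_add_sqrt_of_isMinCost (hT : T.Classifies s) (hT' : T'.Classifies s)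
    (ha : ∑ h, a h = #s) (hmin : T.EveryNode (fun t _ => t.IsMinCost fun h => (a h : ℤ)) 0) :
    T.expected a ≤ T'.expected a + k * (k + 5) * √(#s) := by
  set p : Fin (k + 1) → ℝ := fun h => a h / (∑ h, a h : ℕ) with hp
  have hp0 (h) : 0 ≤ p h := by positivity
  have hp1 : ∑ h, p h ≤ 1 := by
    rw [← sum_div, ← Nat.cast_sum]
    exact div_self_le_one _
  have hE : k / 2 * urnPotential p a = k * (k + 5) * √(#s) := by
    rw [urnPotential, sqDeviation_div_sum, ha, Fintype.card_fin]
    push_cast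
    ring
  have key := expected_le_add (a := a) (E := fun b => k / 2 * urnPotential p b) ?_ ?_ hT hT'
    zero_le (by simpa using ha) (by simpa using ha) hmin
  · simpa only [tsub_zero, hE] using key
  · simp [urnPotential]
  · intro t u ht _ t'
    have htp : ∑ h, (t.depth h : ℝ) * p h ≤ ∑ h, (t'.depth h : ℝ) * p h := by
      simp only [hp, mul_div_assoc', ← sum_div]
      exact div_le_div_of_nonneg_right (ht.sum_depth_mul_le t') (Nat.cast_nonneg _)
    have hloss := ComparisonTree.sum_depth_mul_le_add_sum_abs_deviation htp (a - u)
    have hdrift := mul_le_mul_of_nonneg_left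
      (two_mul_sum_abs_deviation_add_sum_mul_urnPotential_le hp0 hp1 (a - u))
      (by positivity : (0 : ℝ) ≤ k / 2)
    simp only [mul_left_comm _ ((k : ℝ) / 2), ← mul_sum]
    linear_combination hloss + hdrift

end ClassificationTree

theorem mem_nonPivots {i : Fin n} : i ∈ nonPivots k n ↔ k ≤ (i : ℕ) := by
  simp [nonPivots]

theorem card_nonPivots_add (h : k ≤ n) : #(nonPivots k n) + k = n := by
  have hcompl : #{i : Fin n | ¬ k ≤ (i : ℕ)} = k := by
    simp only [not_le, Fin.card_filter_val_lt]
    omega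
  have hsplit := card_filter_add_card_filter_not (s := (univ : Finset (Fin n))) (k ≤ ·.val)
  rwa [hcompl, card_univ, Fintype.card_fin] at hsplit

theorem swap_mem_nonPivots_iff {i j : Fin n} (hi : i ∈ nonPivots k n) (hj : j ∈ nonPivots k n)
    (x : Fin n) : Equiv.swap i j x ∈ nonPivots k n ↔ x ∈ nonPivots k n := by
  rw [Equiv.swap_apply_def]
  split_ifs with hxi hxj
  · simp [hxi, hi, hj]
  · simp [hxj, hi, hj]
  · rfl

theorem group_mul_swap (σ : Equiv.Perm (Fin n)) {i j : Fin n}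
    (hi : i ∈ nonPivots k n) (hj : j ∈ nonPivots k n) (x : Fin n) :
    group k (σ * Equiv.swap i j) x = group k σ (Equiv.swap i j x) := by
  have hbelow : pivotsBelow k (σ * Equiv.swap i j) x = pivotsBelow k σ (Equiv.swap i j x) := by
    refine filter_congr fun y _ => and_congr_right fun hy => ?_
    have hne {z} (hz : z ∈ nonPivots k n) : y ≠ z := by
      rintro rfl
      exact (mem_nonPivots.1 hz).not_gt hy
    rw [Equiv.Perm.mul_apply, Equiv.Perm.mul_apply,
      Equiv.swap_apply_of_ne_of_ne (hne hi) (hne hj)]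
  simp only [group, hbelow]

theorem groupSizes_mul_swap (σ : Equiv.Perm (Fin n)) {i j : Fin n}
    (hi : i ∈ nonPivots k n) (hj : j ∈ nonPivots k n) :
    groupSizes k (σ * Equiv.swap i j) = groupSizes k σ := by
  funext h
  refine card_equiv (Equiv.swap i j) fun x => ?_
  rw [mem_filter, mem_filter, group_mul_swap σ hi hj, swap_mem_nonPivots_iff hi hj]

theorem sum_groupSizes (σ : Equiv.Perm (Fin n)) : ∑ h, groupSizes k σ h = #(nonPivots k n) :=
  (card_eq_sum_card_fiberwise (f := group k σ) (t := univ) fun _ _ => mem_coe.2 (mem_univ _)).symm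

theorem isExchangeable_group (a : Fin (k + 1) → ℕ) :
    IsExchangeable {σ : Equiv.Perm (Fin n) | groupSizes k σ = a} (group k) (nonPivots k n) a where
  exists_swap i hi j hj := by
    refine ⟨Equiv.mulRight (Equiv.swap i j), fun σ => ⟨?_, group_mul_swap σ hi hj⟩⟩
    rw [mem_filter_univ, mem_filter_univ, Equiv.coe_mulRight, groupSizes_mul_swap σ hi hj]
  card_filter_eq σ hσ h := congr_fun (mem_filter_univ σ |>.1 hσ) h

namespace Strategy

theorem averageCount_eq_sum_expected (S : Strategy k n) :
    S.averageCount =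
      (∑ σ : Equiv.Perm (Fin n), (S.tree (groupSizes k σ)).expected (groupSizes k σ)) /
        (n.factorial : ℝ) := by
  have hmaps : ∀ σ ∈ (univ : Finset (Equiv.Perm (Fin n))),
      groupSizes k σ ∈ univ.image (groupSizes k) := fun σ _ => mem_image_of_mem _ (mem_univ σ)
  rw [averageCount, ← sum_fiberwise_of_maps_to hmaps, ← sum_fiberwise_of_maps_to' hmaps
    fun a => (S.tree a).expected a]
  congr 1
  refine sum_congr rfl fun a _ => ?_
  rw [sum_const, nsmul_eq_mul,
    ← (S.tree a).sum_comparisons_eq (S.classifies a) (isExchangeable_group a)]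
  exact sum_congr rfl fun σ hσ => by rw [(mem_filter_univ σ).1 hσ]

theorem averageCount_le_add (hkn : k ≤ n) {S S' : Strategy k n} {B : ℝ}
    (h : ∀ a : Fin (k + 1) → ℕ, ∑ j, a j + k = n →
      (S.tree a).expected a ≤ (S'.tree a).expected a + B) :
    S.averageCount ≤ S'.averageCount + B := by
  have hpos : (0 : ℝ) < n.factorial := Nat.cast_pos.2 n.factorial_pos
  rw [averageCount_eq_sum_expected, averageCount_eq_sum_expected, div_add' _ _ _ hpos.ne']
  gcongr
  calc ∑ σ : Equiv.Perm (Fin n), (S.tree (groupSizes k σ)).expected (groupSizes k σ)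
    _ ≤ ∑ σ : Equiv.Perm (Fin n), ((S'.tree (groupSizes k σ)).expected (groupSizes k σ) + B) :=
        sum_le_sum fun σ _ => h _ (by rw [sum_groupSizes, card_nonPivots_add hkn])
    _ = _ := by
        rw [sum_add_distrib, sum_const, card_univ, Fintype.card_perm, Fintype.card_fin,
          nsmul_eq_mul, mul_comm B]

theorem IsO.averageCount_le {O : Strategy k n} (hO : O.IsO) (hkn : k ≤ n) (S : Strategy k n) :
    O.averageCount ≤ S.averageCount := by
  rw [← add_zero S.averageCount]
  refine averageCount_le_add hkn fun a ha => ?_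
  have hcard := card_nonPivots_add hkn
  rw [add_zero]
  exact ClassificationTree.expected_le_of_isMinCost_sub (O.classifies a) (S.classifies a)
    (by omega) (hO a ha)

theorem IsN.averageCount_le_add_sqrt {N : Strategy k n} (hN : N.IsN) (hkn : k ≤ n)
    (S : Strategy k n) : N.averageCount ≤ S.averageCount + k * (k + 5) * √n := by
  refine averageCount_le_add hkn fun a ha => ?_
  have hcard := card_nonPivots_add hkn
  calc (N.tree a).expected a
    _ ≤ (S.tree a).expected a + k * (k + 5) * √(#(nonPivots k n)) :=
        ClassificationTree.expected_le_add_sqrt_of_isMinCost (N.classifies a) (S.classifies a)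
          (by omega) (hN a ha)
    _ ≤ (S.tree a).expected a + k * (k + 5) * √n := by
        gcongr
        omega

end Strategy

end MultiPivot

/-- For every number `k` of pivots, strategy `N_k` is asymptotically optimal: its average comparison
count differs by at most `O(n^(1-ε))` from that of the optimal strategy `O_k`, and it exceeds the
average comparison count of no classification strategy by more than `O(n^(1-ε))`. -/
theorem mainTheorem5 (k : ℕ) (hk : 1 ≤ k) :
    ∃ ε : ℝ, 0 < ε ∧ ∃ C : ℝ, ∀ n : ℕ, k ≤ n →
      ∀ N : MultiPivot.Strategy k n, N.IsN →
        (∀ O : MultiPivot.Strategy k n, O.IsO →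
          |N.averageCount - O.averageCount| ≤ C * (n : ℝ) ^ (1 - ε)) ∧
        (∀ S : MultiPivot.Strategy k n,
          N.averageCount ≤ S.averageCount + C * (n : ℝ) ^ (1 - ε)) := by
  refine ⟨1 / 2, by norm_num, k * (k + 5), fun n hkn N hN => ?_⟩
  have hsqrt : (n : ℝ) ^ (1 - 1 / 2 : ℝ) = √n := by
    rw [Real.sqrt_eq_rpow]
    norm_num
  rw [hsqrt]
  refine ⟨fun O hO => ?_, hN.averageCount_le_add_sqrt hkn⟩
  rw [abs_of_nonneg (sub_nonneg.2 (hO.averageCount_le hkn N))]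
  exact sub_le_iff_le_add'.2 (hN.averageCount_le_add_sqrt hkn O)
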